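/- Call a finite group \emph{semisimple} if it is isomorphic to a direct product of finitely many (possibly zero) non-abelian finite simple groups. A group $G$ is a \emph{central extension} of a group $S$ if there is a surjective homomorphism $G\to S$ whose kernel lies in the center of $G$. A finite group is \emph{quasisimple} if it is perfect and is a central extension of a non-abelian finite simple group. A group $G$ is a \emph{subdirect product} of groups $(H_i)_{i\in I}$ if it embeds into $\prod_{i\in I} H_i$ so that each coordinate projection maps $G$ onto $H_i$. A group $G$ is the \emph{central product} of subgroups $(H_i)_{i\in I}$ if these subgroups generate $G$ and $H_i$, $H_j$ commute elementwise for all $i\neq j$. \textbf{Proposition.} The following three classes of groups are the same: \begin{enumerate} \item the smallest class of groups that contains all finite quasisimple groups and is closed under subdirect products of finitely many groups and under quotients (homomorphic images); \item the class of finite groups that are central extensions of a finite semisimple group; \item the class of central products of finitely many groups, each of which is a finite quasisimple group or a finite abelian group. \end{enumerate} -/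

import Mathlib

universe u

namespace GroupClasses

/-- A class of groups, as a predicate on groups. -/
abbrev GroupClass : Type (u + 1) := ∀ (G : Type u) [Group G], Prop

/-- `S` is a non-abelian finite simple group. -/
structure IsNonabelianFiniteSimple (S : Type u) [Group S] : Prop where
  finite : Finite S
  simple : IsSimpleGroup S
  nonabelian : ∃ a b : S, a * b ≠ b * a

/-- `G` is a finite semisimple group: isomorphic to the direct product of a finite, possibly empty,
family of non-abelian finite simple groups. -/
def IsFiniteSemisimple (G : Type u) [Group G] : Prop :=
  ∃ (ι : Type) (_ : Finite ι) (S : ι → Type u) (_ : ∀ i, Group (S i)),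
    (∀ i, IsNonabelianFiniteSimple (S i)) ∧ Nonempty (G ≃* ∀ i, S i)

/-- `G` is a central extension of `S`: there is a surjection `G → S` with central kernel. -/
def IsCentralExtension (G S : Type u) [Group G] [Group S] : Prop :=
  ∃ q : G →* S, Function.Surjective q ∧ q.ker ≤ Subgroup.center G

/-- `G` is a finite quasisimple group: a finite perfect central extension of a non-abelian finite
simple group. -/
structure IsFiniteQuasisimple (G : Type u) [Group G] : Prop where
  finite : Finite G
  perfect : Group.IsPerfect G
  central_extension : ∃ (S : Type u) (_ : Group S),
    IsNonabelianFiniteSimple S ∧ IsCentralExtension G S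

/-- `G` is a finite abelian group. -/
structure IsFiniteAbelian (G : Type u) [Group G] : Prop where
  finite : Finite G
  comm : ∀ a b : G, a * b = b * a

/-- `G` is the (internal) central product of the subgroups `H i`: distinct ones commute
elementwise, and together they generate `G`. -/
structure IsCentralProduct {G : Type u} [Group G] {ι : Type} (H : ι → Subgroup G) : Prop where
  commute : ∀ i j, i ≠ j → ∀ x ∈ H i, ∀ y ∈ H j, x * y = y * x
  generate : (⨆ i, H i) = ⊤

/-- `G` is a subdirect product of the groups `H i`: it embeds into their direct product so that
every coordinate projection is surjective on it. -/
def IsSubdirectProduct (G : Type u) [Group G] {ι : Type} (H : ι → Type u)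
    [∀ i, Group (H i)] : Prop :=
  ∃ f : G →* ∀ i, H i, Function.Injective f ∧ ∀ i, Function.Surjective fun g => f g i

/-- The class is closed under quotients, that is, under surjective homomorphic images
(so in particular under isomorphism). -/
def ClosedUnderQuotients (C : GroupClass.{u}) : Prop :=
  ∀ (G H : Type u) [Group G] [Group H] (f : G →* H), Function.Surjective f → C G → C H

/-- The class is closed under subdirect products of finitely many groups. -/
def ClosedUnderSubdirectProducts (C : GroupClass.{u}) : Prop :=
  ∀ (G : Type u) [Group G] (ι : Type) [Finite ι] (H : ι → Type u) [∀ i, Group (H i)],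
    (∀ i, C (H i)) → IsSubdirectProduct G H → C G

/-- The class contains every finite quasisimple group and is closed under subdirect products and
quotients. -/
structure IsQuasisimpleFormation (C : GroupClass.{u}) : Prop where
  quasisimple : ∀ (G : Type u) [Group G], IsFiniteQuasisimple G → C G
  subdirect : ClosedUnderSubdirectProducts C
  quotient : ClosedUnderQuotients C

/-- The smallest class of groups that contains the finite quasisimple groups and is closed under
subdirect products and quotients: the intersection of all such classes. -/
def SmallestQuasisimpleFormation (G : Type u) [Group G] : Prop :=
  ∀ C : GroupClass.{u}, IsQuasisimpleFormation C → C G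

/-- The intersection of all such classes is itself such a class, hence the smallest one. -/
theorem isQuasisimpleFormation_smallest :
    IsQuasisimpleFormation.{u} (fun G _ => SmallestQuasisimpleFormation G) where
  quasisimple G _ hG _ hC := hC.quasisimple G hG
  subdirect G _ ι _ H _ hH h C hC := hC.subdirect G ι H (fun i => hH i C hC) h
  quotient G H _ _ f hf hG C hC := hC.quotient G H f hf (hG C hC)

/-- `G` is a finite central extension of a finite semisimple group. -/
def IsFiniteCentralExtensionOfSemisimple (G : Type u) [Group G] : Prop :=
  Finite G ∧ ∃ (S : Type u) (_ : Group S), IsFiniteSemisimple S ∧ IsCentralExtension G S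

/-- `G` is a central product of finitely many groups, each of which is finite quasisimple or finite
abelian. -/
def IsCentralProductOfQuasisimpleAndAbelian (G : Type u) [Group G] : Prop :=
  ∃ (ι : Type) (_ : Finite ι) (H : ι → Subgroup G), IsCentralProduct H ∧
    ∀ i, IsFiniteQuasisimple (H i) ∨ IsFiniteAbelian (H i)

end GroupClasses

/-! The classes are shown to contain one another in a circle, (1) ⊆ (2) ⊆ (3) ⊆ (1). Class (2) is
itself closed under the two operations, because finite semisimple groups are closed under quotients
and subdirect products (`IsFiniteSemisimple.of_surjective`,
`IsFiniteSemisimple.of_isSubdirectProduct`). A central extension of a product of simple groups is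
generated by its central kernel and the derived subgroups of the preimages of the factors; these are
quasisimple and commute pairwise. A central product is a quotient of the direct product of its
factors, so (3) ⊆ (1) only needs finite abelian groups. A class as in (1) contains the center of
each member, and `SL n` over a field of prime order `p ≡ 1` mod `n` is quasisimple, for `n ≥ 3`,
with cyclic center of order `n`. -/

/-! ### Special linear groups of degree at least three are quasisimple. -/

namespace Matrix.SpecialLinearGroup

open scoped LinearAlgebra.Projectivization

variable {ι F : Type*} [DecidableEq ι] [Fintype ι] [Field F]

/-- The classical `h(a) = w(a) w(-1)`, where `w(a)` is the monomial matrix given by the first three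
factors. -/
lemma diag2n_eq_prod_transvection {i j : ι} (hij : i ≠ j) (a : F) (ha : a ≠ 0) :
    diag2n hij a ha = transvection hij a * transvection hij.symm (-a⁻¹) * transvection hij a *
      transvection hij (-1) * transvection hij.symm 1 * transvection hij (-1) := by
  apply Subtype.ext
  have h : (diag2n hij a ha).1 = 1 + single i i (a - 1) + single j j (a⁻¹ - 1) := by
    ext k l
    simp only [diag2n_coe, diagonal_apply, add_apply, one_apply, single_apply]
    grind
  rw [h]
  simp only [coe_mul, transvection_coe, mul_add, add_mul, one_mul, mul_one, single_mul_single_same,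
    single_mul_single_of_ne _ _ _ _ hij, single_mul_single_of_ne _ _ _ _ hij.symm, add_zero]
  ext k l
  simp only [add_apply, one_apply, single_apply]
  grind

lemma transvection_induction [Nontrivial ι] (P : SpecialLinearGroup ι F → Prop)
    (htransvec : ∀ (i j : ι) (hij : i ≠ j) (a : F), P (transvection hij a))
    (hmul : ∀ A B, P A → P B → P (A * B)) (A : SpecialLinearGroup ι F) : P A := by
  refine diagonal_transvection_induction' P A (fun i j hij c hc ↦ ?_) htransvec hmul
  rw [diag2n_eq_prod_transvection]
  refine hmul _ _ (hmul _ _ (hmul _ _ (hmul _ _ (hmul _ _ ?_ ?_) ?_) ?_) ?_) ?_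
  all_goals exact htransvec _ _ _ _

open scoped commutatorElement in
lemma commutator_transvection {i j k : ι} (hij : i ≠ j) (hjk : j ≠ k) (hik : i ≠ k) (a b : F) :
    ⁅transvection hij a, transvection hjk b⁆ = transvection hik (a * b) := by
  rw [commutatorElement_def, transvection_inv, transvection_inv]
  apply Subtype.ext
  simp only [coe_mul, transvection_coe, mul_add, add_mul, one_mul, mul_one, single_mul_single_same,
    single_mul_single_of_ne _ _ _ _ hij.symm, single_mul_single_of_ne _ _ _ _ hjk.symm,
    single_mul_single_of_ne _ _ _ _ hik.symm, add_zero]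
  ext k l
  simp only [add_apply, one_apply, single_apply]
  grind

/-- A third index makes every transvection a commutator of two others. -/
lemma isPerfect_of_three_le (h : 3 ≤ Fintype.card ι) :
    Group.IsPerfect (SpecialLinearGroup ι F) := by
  have : Nontrivial ι := Fintype.one_lt_card_iff_nontrivial.mp (by omega)
  refine ⟨eq_top_iff.mpr fun A _ ↦ transvection_induction (· ∈ commutator _)
    (fun i j hij a ↦ ?_) (fun _ _ ↦ mul_mem) A⟩
  obtain ⟨k, hk⟩ : ∃ k, k ∉ ({i, j} : Finset ι) := by
    by_contra! hk
    have := Finset.card_le_card (fun k _ ↦ hk k : Finset.univ ⊆ {i, j})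
    have := Finset.card_le_two (a := i) (b := j)
    rw [Finset.card_univ] at *
    omega
  simp only [Finset.mem_insert, Finset.mem_singleton, not_or] at hk
  rw [← mul_one a, ← commutator_transvection (Ne.symm hk.1) hk.2 hij]
  exact Subgroup.commutator_mem_commutator (Subgroup.mem_top _) (Subgroup.mem_top _)

lemma iSup_lineStab_eq_top [Nontrivial ι] :
    (⨆ p : ℙ F (ι → F), lineStab p.submodule) = (⊤ : Subgroup (SpecialLinearGroup ι F)) := by
  refine eq_top_iff.mpr fun A _ ↦ transvection_induction
    (· ∈ ⨆ p : ℙ F (ι → F), lineStab p.submodule) (fun i j hij a ↦ ?_) (fun _ _ ↦ mul_mem) A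
  refine Subgroup.mem_iSup_of_mem
    (Projectivization.mk F (Pi.single i 1 : ι → F) (Pi.single_ne_zero_iff.2 one_ne_zero)) ?_
  rw [Projectivization.submodule_mk]
  exact SL2Gen.transvection_mem_lineStab hij a

end Matrix.SpecialLinearGroup

namespace Matrix.ProjectiveSpecialLinearGroup

open Matrix.SpecialLinearGroup
open scoped LinearAlgebra.Projectivization

variable {ι F : Type*} [DecidableEq ι] [Fintype ι] [Field F]

/-- The Iwasawa structure of the projective special linear group acting on projective space. -/
noncomputable abbrev iwasawaStructure [Nontrivial ι] :
    MulAction.IwasawaStructure (ProjectiveSpecialLinearGroup ι F) (ℙ F (ι → F)) where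
  T := PSL.iwasawaT
  is_comm p := by
    have : IsMulCommutative (lineStab (F := F) (ι := ι) p.submodule) := by
      rw [← Projectivization.mk_rep p, Projectivization.submodule_mk]
      exact lineStab_isMulCommutative_of_span p.rep p.rep_nonzero
    exact Subgroup.map_isMulCommutative _ _
  is_conj g p := by
    obtain ⟨g, rfl⟩ := QuotientGroup.mk_surjective g
    rw [smul_proj_mk]
    change Subgroup.map _ _ = _
    rw [PSL.smul_submodule, lineStab_smul, PSL.iwasawaT_map_conj]
  is_generator := by
    change ⨆ p, Subgroup.map _ _ = _
    rw [← Subgroup.map_iSup, iSup_lineStab_eq_top]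
    exact Subgroup.map_top_of_surjective _ (QuotientGroup.mk'_surjective _)

/-- Iwasawa's criterion for the action on projective space. -/
lemma isSimpleGroup_of_three_le (h : 3 ≤ Fintype.card ι) :
    IsSimpleGroup (ProjectiveSpecialLinearGroup ι F) := by
  have : Nontrivial ι := Fintype.one_lt_card_iff_nontrivial.mp (by omega)
  have := isPerfect_of_three_le (F := F) h
  have : Group.IsPerfect (ProjectiveSpecialLinearGroup ι F) := inferInstance
  exact MulAction.IwasawaStructure.isSimpleGroup this.commutator_eq_top iwasawaStructure
    inferInstance

end Matrix.ProjectiveSpecialLinearGroup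

namespace GroupClasses

open Matrix

lemma exists_mul_ne_mul_of_isPerfect {S : Type*} [Group S] [Nontrivial S] [Group.IsPerfect S] :
    ∃ a b : S, a * b ≠ b * a := by
  by_contra! h
  exact Group.IsPerfect.not_isMulCommutative (G := S) ⟨⟨h⟩⟩

lemma isFiniteQuasisimple_specialLinearGroup {ι : Type} [DecidableEq ι] [Fintype ι]
    (h : 3 ≤ Fintype.card ι) (F : Type u) [Field F] [Finite F] :
    IsFiniteQuasisimple (SpecialLinearGroup ι F) where
  finite := inferInstance
  perfect := SpecialLinearGroup.isPerfect_of_three_le h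
  central_extension := by
    have := SpecialLinearGroup.isPerfect_of_three_le (F := F) h
    have := ProjectiveSpecialLinearGroup.isSimpleGroup_of_three_le (F := F) h
    have : Group.IsPerfect (ProjectiveSpecialLinearGroup ι F) := inferInstance
    exact ⟨ProjectiveSpecialLinearGroup ι F, inferInstance,
      ⟨inferInstance, inferInstance, exists_mul_ne_mul_of_isPerfect⟩,
      QuotientGroup.mk' _, QuotientGroup.mk'_surjective _, by simp⟩

end GroupClasses

/-! ### Central products belong to the smallest class. -/

namespace GroupClasses

lemma SmallestQuasisimpleFormation.pi {ι : Type} [Finite ι] {H : ι → Type u} [∀ i, Group (H i)]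
    (h : ∀ i, SmallestQuasisimpleFormation (H i)) : SmallestQuasisimpleFormation (∀ i, H i) :=
  isQuasisimpleFormation_smallest.subdirect _ ι H h
    ⟨MonoidHom.id _, Function.injective_id, fun i ↦ Function.surjective_eval i⟩

lemma SmallestQuasisimpleFormation.of_surjective {G H : Type u} [Group G] [Group H]
    (h : SmallestQuasisimpleFormation G) (f : G →* H) (hf : Function.Surjective f) :
    SmallestQuasisimpleFormation H :=
  isQuasisimpleFormation_smallest.quotient G H f hf h

/-- The center of `G` is a quotient of `G ×_{G/Z(G)} G`, which is a subdirect product. -/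
lemma SmallestQuasisimpleFormation.center {G : Type u} [Group G]
    (h : SmallestQuasisimpleFormation G) :
    SmallestQuasisimpleFormation (Subgroup.center G) := by
  let K : Subgroup (G × G) :=
    { carrier := {x | x.1⁻¹ * x.2 ∈ Subgroup.center G}
      one_mem' := by simp
      mul_mem' := fun {x y} hx hy ↦ by
        have e : (x * y).1⁻¹ * (x * y).2 = (x.1⁻¹ * x.2) * (y.1⁻¹ * y.2) := by
          have := Subgroup.mem_center_iff.mp hx y.1⁻¹
          simp only [Prod.fst_mul, Prod.snd_mul, mul_inv_rev]
          rw [← mul_assoc (x.1⁻¹ * x.2), ← this]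
          group
        simpa only [Set.mem_ofPred_eq, e] using mul_mem hx hy
      inv_mem' := fun {x} hx ↦ by
        have e : (x⁻¹).1⁻¹ * (x⁻¹).2 = (x.1⁻¹ * x.2)⁻¹ := by
          have := Subgroup.mem_center_iff.mp (inv_mem hx) x.1
          simp only [Prod.fst_inv, Prod.snd_inv, inv_inv]
          rw [← mul_left_inj x.1, ← this]
          group
        simpa only [Set.mem_ofPred_eq, e] using inv_mem hx }
  have hK : SmallestQuasisimpleFormation K := by
    refine isQuasisimpleFormation_smallest.subdirect _ Bool (fun _ ↦ G) (fun _ ↦ h)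
      ⟨MonoidHom.pi fun b ↦ (if b then MonoidHom.fst G G else MonoidHom.snd G G).comp K.subtype,
        fun x y hxy ↦ Subtype.ext (Prod.ext (congrFun hxy true) (congrFun hxy false)), fun b g ↦
        ⟨⟨(g, g), by simp [K]⟩, by cases b <;> rfl⟩⟩
  -- Multiplicative because the quotient of the two coordinates is central on `K`.
  let f : K →* Subgroup.center G :=
    { toFun := fun x ↦ ⟨x.1.1⁻¹ * x.1.2, x.2⟩
      map_one' := by simp
      map_mul' := fun x y ↦ Subtype.ext <| by
        have := Subgroup.mem_center_iff.mp x.2 y.1.1⁻¹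
        simp only [Subgroup.coe_mul, Prod.fst_mul, Prod.snd_mul, mul_inv_rev]
        rw [← mul_assoc (x.1.1⁻¹ * x.1.2), ← this]
        group }
  exact hK.of_surjective f fun z ↦ ⟨⟨(1, z), by simp [K]⟩, by simp [f]⟩

/-- For `n ≥ 3`, a finite field whose multiplicative group has an element of order `n` gives a
quasisimple special linear group with cyclic center of order `n`. -/
lemma smallestQuasisimpleFormation_zmod_of_three_le {n : ℕ} (hn : 3 ≤ n) :
    SmallestQuasisimpleFormation (ULift.{u} (Multiplicative (ZMod n))) := by
  -- A prime `p ≡ 1` mod `n` makes the field of order `p` contain all `n`-th roots of unity.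
  obtain ⟨p, hp, -, hpn⟩ := Nat.exists_prime_gt_modEq_one 0 (show n ≠ 0 by omega)
  have : Fact p.Prime := ⟨hp⟩
  have : NeZero n := ⟨by omega⟩
  let F := ULift.{u} (ZMod p)
  have hF : Nat.card Fˣ = p - 1 := by
    rw [Nat.card_units, Nat.card_congr Equiv.ulift, Nat.card_zmod]
  have hdvd : n ∣ p - 1 := (Nat.modEq_iff_dvd' hp.one_le).mp hpn.symm
  obtain ⟨g, hg⟩ := IsCyclic.exists_ofOrder_eq_natCard (α := Fˣ)
  rw [hF] at hg
  have hcard : Nat.card (rootsOfUnity n F) = n := by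
    have h0 : orderOf g ≠ 0 := by rw [hg]; have := hp.two_le; omega
    rw [← hg] at hdvd
    have : IsPrimitiveRoot (g ^ (orderOf g / n)) n := by
      have := IsPrimitiveRoot.orderOf (g ^ (orderOf g / n))
      rwa [orderOf_pow_orderOf_div h0 hdvd] at this
    exact this.card_rootsOfUnity'
  let e₁ := Matrix.SpecialLinearGroup.center_equiv_rootsOfUnity' (n := Fin n) (R := F) 0
  rw [Fintype.card_fin] at e₁
  let e₂ : Multiplicative (ZMod n) ≃* rootsOfUnity n F :=
    mulEquivOfCyclicCardEq (by rw [hcard]; simp)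
  let e := e₁.trans (e₂.symm.trans MulEquiv.ulift.symm)
  have h : SmallestQuasisimpleFormation (Matrix.SpecialLinearGroup (Fin n) F) :=
    isQuasisimpleFormation_smallest.quasisimple _
      (isFiniteQuasisimple_specialLinearGroup (by simpa using hn) F)
  exact h.center.of_surjective e.toMonoidHom e.surjective

lemma smallestQuasisimpleFormation_zmod {n : ℕ} (hn : n ≠ 0) :
    SmallestQuasisimpleFormation (ULift.{u} (Multiplicative (ZMod n))) := by
  -- Passing to the multiple `n * 3 ≥ 3` covers `n = 1, 2`.
  have h := smallestQuasisimpleFormation_zmod_of_three_le.{u} (n := n * 3) (by omega)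
  let f := (ZMod.castHom (dvd_mul_right n 3) (ZMod n)).toAddMonoidHom.toMultiplicative
  refine h.of_surjective (MulEquiv.ulift.symm.toMonoidHom.comp (f.comp MulEquiv.ulift.toMonoidHom))
    (MulEquiv.ulift.symm.surjective.comp
      (Function.Surjective.comp (g := f) ?_ MulEquiv.ulift.surjective))
  exact ZMod.castHom_surjective (dvd_mul_right n 3)

lemma IsFiniteAbelian.smallestQuasisimpleFormation {A : Type u} [Group A]
    (hA : IsFiniteAbelian A) : SmallestQuasisimpleFormation A := by
  have := hA.finite
  let _ : CommGroup A := { ‹Group A› with mul_comm := hA.comm }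
  obtain ⟨ι, _, n, hn, ⟨e⟩⟩ := CommGroup.equiv_prod_multiplicative_zmod_of_finite A
  let e' := (MulEquiv.piCongrRight fun i ↦
    (MulEquiv.ulift.{_, u} : ULift.{u} (Multiplicative (ZMod (n i))) ≃* _)).trans e.symm
  refine (SmallestQuasisimpleFormation.pi fun i ↦ smallestQuasisimpleFormation_zmod.{u}
    (n := n i) ?_).of_surjective e'.toMonoidHom e'.surjective
  have := hn i
  omega

lemma IsCentralProductOfQuasisimpleAndAbelian.smallestQuasisimpleFormation {G : Type u} [Group G]
    (hG : IsCentralProductOfQuasisimpleAndAbelian G) : SmallestQuasisimpleFormation G := by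
  obtain ⟨ι, _, H, hH, h⟩ := hG
  have := Fintype.ofFinite ι
  have hcomm : Pairwise fun i j ↦ ∀ x y : G, x ∈ H i → y ∈ H j → Commute x y :=
    fun i j hij x y hx hy ↦ hH.commute i j hij x hx y hy
  have hpi : SmallestQuasisimpleFormation (∀ i, H i) := .pi fun i ↦
    (h i).elim (isQuasisimpleFormation_smallest.quasisimple _)
      IsFiniteAbelian.smallestQuasisimpleFormation
  refine hpi.of_surjective (Subgroup.noncommPiCoprod hcomm) ?_
  rw [← MonoidHom.range_eq_top, Subgroup.noncommPiCoprod_range, hH.generate]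

end GroupClasses

/-! ### Closure properties of semisimple groups and their central extensions. -/

namespace GroupClasses

lemma IsNonabelianFiniteSimple.center_eq_bot {S : Type*} [Group S]
    (h : IsNonabelianFiniteSimple S) : Subgroup.center S = ⊥ := by
  have := h.simple
  refine (Subgroup.Normal.eq_bot_or_eq_top (H := Subgroup.center S) inferInstance).resolve_right ?_
  intro hc
  obtain ⟨a, b, hab⟩ := h.nonabelian
  exact hab (Subgroup.mem_center_iff.mp (hc ▸ Subgroup.mem_top b) a)

lemma IsNonabelianFiniteSimple.exists_mul_ne_mul {S : Type*} [Group S]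
    (h : IsNonabelianFiniteSimple S) {a : S} (ha : a ≠ 1) : ∃ b, a * b ≠ b * a := by
  by_contra! hb
  have : a ∈ Subgroup.center S := Subgroup.mem_center_iff.mpr fun b ↦ (hb b).symm
  rw [h.center_eq_bot] at this
  exact ha this

/-- Otherwise the centralizer of `a` contains the normal closure of `b`, which is all of `S`. -/
lemma IsNonabelianFiniteSimple.exists_mul_conj_ne {S : Type*} [Group S]
    (h : IsNonabelianFiniteSimple S) {a b : S} (ha : a ≠ 1) (hb : b ≠ 1) :
    ∃ c, a * (c * b * c⁻¹) ≠ (c * b * c⁻¹) * a := by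
  by_contra! hc
  have := h.simple
  have hle : Subgroup.normalClosure {b} ≤ Subgroup.centralizer {a} := by
    refine (Subgroup.closure_le _).mpr fun x hx ↦ ?_
    obtain ⟨y, rfl, hy⟩ := Group.mem_conjugatesOfSet_iff.mp hx
    obtain ⟨c, rfl⟩ := isConj_iff.mp hy
    exact Subgroup.mem_centralizer_singleton_iff.mpr (hc c).symm
  have htop : Subgroup.normalClosure {b} = ⊤ :=
    (Subgroup.Normal.eq_bot_or_eq_top Subgroup.normalClosure_normal).resolve_left fun hbot ↦
      hb <| by
        have := Subgroup.subset_normalClosure (Set.mem_singleton b)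
        rwa [hbot] at this
  obtain ⟨c, hc⟩ := h.exists_mul_ne_mul ha
  exact hc (Subgroup.mem_centralizer_singleton_iff.mp (hle (htop ▸ Subgroup.mem_top c))).symm

section Pi

variable {ι : Type*} [DecidableEq ι] {S : ι → Type*} [∀ i, Group (S i)]

/-- A normal subgroup of a product of non-abelian simple groups contains every factor on which it
projects nontrivially. -/
lemma mulSingle_mem_of_apply_ne_one (M : Subgroup (∀ i, S i)) [M.Normal] {i : ι}
    (h : IsNonabelianFiniteSimple (S i)) {m : ∀ i, S i} (hm : m ∈ M) (hmi : m i ≠ 1) (s : S i) :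
    Pi.mulSingle i s ∈ M := by
  have := h.simple
  let N := M.comap (MonoidHom.mulSingle S i)
  have hN : N = ⊤ := by
    refine (Subgroup.Normal.eq_bot_or_eq_top (H := N) inferInstance).resolve_left fun hbot ↦ ?_
    obtain ⟨b, hb⟩ := h.exists_mul_ne_mul hmi
    -- The commutator of `m` with an element supported at `i` stays in `M` and is supported at `i`.
    have hmem : m i * b * (m i)⁻¹ * b⁻¹ ∈ N := by
      have : MonoidHom.mulSingle S i (m i * b * (m i)⁻¹ * b⁻¹) =
          m * (Pi.mulSingle i b * m⁻¹ * (Pi.mulSingle i b)⁻¹) := by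
        ext j
        by_cases hj : j = i
        · subst hj
          simp [mul_assoc]
        · simp [hj]
      rw [Subgroup.mem_comap, this]
      exact mul_mem hm (Subgroup.Normal.conj_mem inferInstance _ (inv_mem hm) _)
    rw [hbot, Subgroup.mem_bot, mul_inv_eq_one, mul_inv_eq_iff_eq_mul] at hmem
    exact hb hmem
  exact (hN ▸ Subgroup.mem_top s : s ∈ N)

end Pi

lemma IsFiniteSemisimple.of_surjective {G H : Type u} [Group G] [Group H]
    (hG : IsFiniteSemisimple G) (f : G →* H) (hf : Function.Surjective f) :
    IsFiniteSemisimple H := by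
  classical
  obtain ⟨ι, _, S, _, hS, ⟨e⟩⟩ := hG
  let g : (∀ i, S i) →* H := f.comp e.symm.toMonoidHom
  have hg : Function.Surjective g := hf.comp e.symm.surjective
  -- The kernel is the product of the factors it meets nontrivially; `κ` indexes the surviving ones.
  let κ := {i : ι // ∀ m ∈ g.ker, m i = 1}
  let π : (∀ i, S i) →* ∀ k : κ, S k := MonoidHom.pi fun k ↦ Pi.evalMonoidHom S k
  have hπ : Function.Surjective π := fun y ↦
    ⟨fun i ↦ if h : ∀ m ∈ g.ker, m i = 1 then y ⟨i, h⟩ else 1, funext fun k ↦ dif_pos k.2⟩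
  have hker : g.ker = π.ker := by
    refine le_antisymm (fun m hm ↦ funext fun k ↦ k.2 m hm) fun m hm ↦ ?_
    refine Subgroup.pi_mem_of_mulSingle_mem m fun i ↦ ?_
    by_cases hi : ∀ m ∈ g.ker, m i = 1
    · have : m i = 1 := congrFun hm (⟨i, hi⟩ : κ)
      rw [this, Pi.mulSingle_one]
      exact one_mem _
    · push Not at hi
      obtain ⟨x, hx, hxi⟩ := hi
      exact mulSingle_mem_of_apply_ne_one g.ker (hS i) hx hxi (m i)
  exact ⟨κ, inferInstance, fun k ↦ S k, inferInstance, fun k ↦ hS k,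
    ⟨(QuotientGroup.quotientKerEquivOfSurjective g hg).symm.trans
      ((QuotientGroup.quotientMulEquivOfEq hker).trans
        (QuotientGroup.quotientKerEquivOfSurjective π hπ))⟩⟩

section Subdirect

variable {G ι : Type*} [Group G] {S : ι → Type*} [∀ i, Group (S i)]

/-- Induction on `s`: if `g` dies on `s` and `h` dies at `i`, the commutator of `g` with a conjugate
of `h` dies on both, and the conjugate can be chosen so that it survives at `j`. -/
lemma exists_apply_eq_one_of_ker_injective (hS : ∀ i, IsNonabelianFiniteSimple (S i))
    (f : ∀ i, G →* S i) (hf : ∀ i, Function.Surjective (f i))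
    (hker : Function.Injective fun i ↦ (f i).ker) (s : Finset ι) (j : ι) (hj : j ∉ s) :
    ∃ g, (∀ i ∈ s, f i g = 1) ∧ f j g ≠ 1 := by
  classical
  induction s using Finset.induction_on with
  | empty =>
    have := (hS j).simple
    obtain ⟨a, ha⟩ := exists_ne (1 : S j)
    obtain ⟨g, rfl⟩ := hf j a
    exact ⟨g, by simp, ha⟩
  | insert i s hi ih =>
    rw [Finset.mem_insert, not_or] at hj
    obtain ⟨g, hgs, hgj⟩ := ih hj.2
    obtain ⟨h, hhi, hhj⟩ : ∃ h, f i h = 1 ∧ f j h ≠ 1 := by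
      -- By simplicity of `S i`, the larger kernel would equal the smaller one or be all of `G`.
      by_contra! hle
      have hle : (f i).ker ≤ (f j).ker := hle
      have := (hS i).simple
      have := (hS j).simple
      have hN : ((f j).ker.map (f i)).Normal := Subgroup.Normal.map inferInstance _ (hf i)
      have hcomap := Subgroup.comap_map_eq (f i) (f j).ker
      rw [sup_eq_left.mpr hle] at hcomap
      obtain hN | hN := hN.eq_bot_or_eq_top
      · rw [hN, MonoidHom.comap_bot] at hcomap
        exact hj.1 (hker hcomap.symm)
      · rw [hN, Subgroup.comap_top] at hcomap
        obtain ⟨a, ha⟩ := exists_ne (1 : S j)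
        obtain ⟨g, rfl⟩ := hf j a
        exact ha (hcomap ▸ Subgroup.mem_top g : g ∈ (f j).ker)
    obtain ⟨c, hc⟩ := (hS j).exists_mul_conj_ne hgj hhj
    obtain ⟨c, rfl⟩ := hf j c
    refine ⟨g * (c * h * c⁻¹) * g⁻¹ * (c * h * c⁻¹)⁻¹, fun k hk ↦ ?_, fun h1 ↦ hc ?_⟩
    · obtain rfl | hk := Finset.mem_insert.mp hk
      · simp [hhi]
      · simp [hgs k hk]
    · rw [map_mul, map_inv, mul_inv_eq_one, map_mul, map_inv, mul_inv_eq_iff_eq_mul] at h1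
      simpa using h1

/-- A homomorphism to a finite product of non-abelian simple groups is surjective if its coordinates
are surjective with pairwise distinct kernels. -/
lemma pi_surjective_of_ker_injective [Finite ι] (hS : ∀ i, IsNonabelianFiniteSimple (S i))
    (f : ∀ i, G →* S i) (hf : ∀ i, Function.Surjective (f i))
    (hker : Function.Injective fun i ↦ (f i).ker) : Function.Surjective (MonoidHom.pi f) := by
  classical
  have := Fintype.ofFinite ι
  rw [← MonoidHom.range_eq_top, eq_top_iff]
  refine fun y _ ↦ Subgroup.pi_mem_of_mulSingle_mem y fun j ↦ ?_
  let N := (MonoidHom.pi f).range.comap (MonoidHom.mulSingle S j)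
  -- Conjugation by any element of `S j` lifts to `G`, since `f j` is surjective.
  have hN : N.Normal := by
    refine ⟨fun s ⟨x, hx⟩ c ↦ ?_⟩
    obtain ⟨c, rfl⟩ := hf j c
    refine ⟨c * x * c⁻¹, ?_⟩
    rw [map_mul, map_mul, hx, map_inv]
    ext k
    by_cases hk : k = j
    · subst hk
      simp
    · simp [hk]
  have := (hS j).simple
  have hN : N = ⊤ := hN.eq_bot_or_eq_top.resolve_left fun hbot ↦ by
    obtain ⟨g, hg, hgj⟩ := exists_apply_eq_one_of_ker_injective hS f hf hker (Finset.univ.erase j) j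
      (Finset.notMem_erase j _)
    have : f j g ∈ N := by
      refine ⟨g, funext fun k ↦ ?_⟩
      by_cases hk : k = j
      · subst hk
        simp
      · simp [hk, hg k (by simp [hk])]
    rw [hbot] at this
    exact hgj this
  exact (hN ▸ Subgroup.mem_top (y j) : y j ∈ N)

end Subdirect

/-- One coordinate is kept for each distinct kernel: this loses no injectivity and makes the
embedding onto. -/
lemma isFiniteSemisimple_of_isSubdirectProduct_simple {G : Type u} [Group G] {ι : Type} [Finite ι]
    {S : ι → Type u} [∀ i, Group (S i)] (hS : ∀ i, IsNonabelianFiniteSimple (S i))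
    (h : IsSubdirectProduct G S) : IsFiniteSemisimple G := by
  obtain ⟨f, hinj, hsurj⟩ := h
  let p (i : ι) : G →* S i := (Pi.evalMonoidHom S i).comp f
  let r : Setoid ι := Setoid.ker fun i ↦ (p i).ker
  have hout (i : ι) : (p (Quotient.mk r i).out).ker = (p i).ker := Quotient.mk_out (s := r) i
  let F : G →* ∀ k : Quotient r, S k.out := MonoidHom.pi fun k ↦ p k.out
  have hF : Function.Surjective F := pi_surjective_of_ker_injective (fun k ↦ hS k.out) _
    (fun k ↦ hsurj k.out) fun k l hkl ↦ by
      rw [← k.out_eq, ← l.out_eq]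
      exact Quotient.sound hkl
  refine ⟨Quotient r, inferInstance, fun k ↦ S k.out, inferInstance, fun k ↦ hS k.out,
    ⟨MulEquiv.ofBijective F ⟨(injective_iff_map_eq_one F).mpr fun g hg ↦ ?_, hF⟩⟩⟩
  refine (injective_iff_map_eq_one f).mp hinj g (funext fun i ↦ ?_)
  have : g ∈ (p (Quotient.mk r i).out).ker := congrFun hg (Quotient.mk r i)
  rw [hout] at this
  exact this

lemma IsFiniteSemisimple.of_isSubdirectProduct {G : Type u} [Group G] {ι : Type} [Finite ι]
    {H : ι → Type u} [∀ i, Group (H i)] (hH : ∀ i, IsFiniteSemisimple (H i))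
    (h : IsSubdirectProduct G H) : IsFiniteSemisimple G := by
  choose κ _ S _ hS e using hH
  obtain ⟨f, hinj, hsurj⟩ := h
  refine isFiniteSemisimple_of_isSubdirectProduct_simple (ι := Σ i, κ i) (S := fun x ↦ S x.1 x.2)
    (fun x ↦ hS x.1 x.2) ⟨MonoidHom.pi fun x ↦ (Pi.evalMonoidHom _ x.2).comp
      ((e x.1).some.toMonoidHom.comp ((Pi.evalMonoidHom H x.1).comp f)), ?_, fun x ↦ ?_⟩
  · exact fun a b hab ↦ hinj <| funext fun i ↦ (e i).some.injective <| funext fun k ↦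
      congrFun hab ⟨i, k⟩
  · exact (Function.surjective_eval x.2).comp ((e x.1).some.surjective.comp (hsurj x.1))

lemma IsNonabelianFiniteSimple.isFiniteSemisimple {S : Type u} [Group S]
    (h : IsNonabelianFiniteSimple S) : IsFiniteSemisimple S :=
  isFiniteSemisimple_of_isSubdirectProduct_simple (ι := Unit) (S := fun _ ↦ S) (fun _ ↦ h)
    ⟨MonoidHom.pi fun _ ↦ MonoidHom.id S, fun _ _ hab ↦ congrFun hab (),
      fun _ ↦ Function.surjective_id⟩

lemma isQuasisimpleFormation_isFiniteCentralExtensionOfSemisimple :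
    IsQuasisimpleFormation.{u} (fun G _ ↦ IsFiniteCentralExtensionOfSemisimple G) where
  quasisimple G _ hG := by
    obtain ⟨S, _, hS, h⟩ := hG.central_extension
    exact ⟨hG.finite, S, _, hS.isFiniteSemisimple, h⟩
  subdirect G _ ι _ H _ hH h := by
    choose _ S _ hS q hq hc using hH
    obtain ⟨f, hinj, hsurj⟩ := h
    let φ : G →* ∀ i, S i := MonoidHom.pi fun i ↦ (q i).comp ((Pi.evalMonoidHom H i).comp f)
    refine ⟨Finite.of_injective f hinj, φ.range, inferInstance, .of_isSubdirectProduct hS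
      ⟨φ.range.subtype, Subtype.val_injective, fun i s ↦ ?_⟩, φ.rangeRestrict,
      φ.rangeRestrict_surjective, ?_⟩
    · obtain ⟨g, rfl⟩ := (hq i).comp (hsurj i) s
      exact ⟨⟨φ g, g, rfl⟩, rfl⟩
    · rw [MonoidHom.ker_rangeRestrict]
      refine fun g hg ↦ Subgroup.mem_center_iff.mpr fun x ↦ hinj ?_
      rw [map_mul, map_mul]
      exact funext fun i ↦ Subgroup.mem_center_iff.mp (hc i (congrFun hg i)) (f x i)
  quotient G H _ _ f hf hG := by
    obtain ⟨_, S, _, hS, q, hq, hc⟩ := hG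
    have : (f.ker.map q).Normal := Subgroup.Normal.map inferInstance q hq
    let p := QuotientGroup.mk' (f.ker.map q)
    have hp : Function.Surjective p := QuotientGroup.mk'_surjective _
    let q' : H →* S ⧸ f.ker.map q := f.liftOfSurjective hf ⟨p.comp q, fun k hk ↦
      (QuotientGroup.eq_one_iff _).mpr (Subgroup.mem_map_of_mem q hk)⟩
    have hq' (g : G) : q' (f g) = p (q g) := MonoidHom.liftOfRightInverse_comp_apply _ _ _ _ g
    refine ⟨Finite.of_surjective f hf, _, _, hS.of_surjective p hp, q', fun s ↦ ?_, fun h hh ↦ ?_⟩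
    · obtain ⟨g, rfl⟩ := (hp.comp hq) s
      exact ⟨f g, hq' g⟩
    · obtain ⟨g, rfl⟩ := hf h
      rw [MonoidHom.mem_ker, hq'] at hh
      obtain ⟨k, hk, hkg⟩ := (QuotientGroup.eq_one_iff _).mp hh
      -- Correcting `g` by `k` in the kernel of `f` puts it in the kernel of `q` without changing
      -- its image in `H`.
      have hgk : g * k⁻¹ ∈ Subgroup.center G := hc (by simp [MonoidHom.mem_ker, hkg])
      refine Subgroup.mem_center_iff.mpr fun x ↦ ?_
      obtain ⟨x, rfl⟩ := hf x
      have hk : f k = 1 := hk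
      simpa [hk] using congrArg f (Subgroup.mem_center_iff.mp hgk x)

end GroupClasses

/-! ### Quasisimple components of a central extension. -/

namespace GroupClasses

open scoped commutatorElement

lemma IsNonabelianFiniteSimple.isPerfect {S : Type*} [Group S]
    (h : IsNonabelianFiniteSimple S) : Group.IsPerfect S := by
  have := h.simple
  refine ⟨(Subgroup.Normal.eq_bot_or_eq_top (H := commutator S) inferInstance).resolve_left ?_⟩
  intro hbot
  obtain ⟨a, b, hab⟩ := h.nonabelian
  have : ⁅a, b⁆ ∈ commutator S :=
    Subgroup.commutator_mem_commutator (Subgroup.mem_top a) (Subgroup.mem_top b)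
  rw [hbot, Subgroup.mem_bot, commutatorElement_eq_one_iff_mul_comm] at this
  exact hab this

lemma commutator_mul_mul_of_mem_center {G : Type*} [Group G] (a b : G) {y z : G}
    (hy : y ∈ Subgroup.center G) (hz : z ∈ Subgroup.center G) : ⁅a * y, b * z⁆ = ⁅a, b⁆ := by
  have hy (g : G) : g * y = y * g := Subgroup.mem_center_iff.mp hy g
  have hz (g : G) : g * z = z * g := Subgroup.mem_center_iff.mp hz g
  calc ⁅a * y, b * z⁆ = a * (y * (b * z)) * y⁻¹ * a⁻¹ * z⁻¹ * b⁻¹ := by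
        rw [commutatorElement_def]
        group
    _ = a * b * (z * a⁻¹) * z⁻¹ * b⁻¹ := by
        rw [← hy]
        group
    _ = ⁅a, b⁆ := by
        rw [← hz, commutatorElement_def]
        group

section

variable {G ι : Type*} [Group G] [DecidableEq ι] {S : ι → Type*} [∀ i, Group (S i)]
  (q : G →* ∀ i, S i)

/-- The derived subgroup of the preimage of the `i`-th factor. In a central extension of a product
of non-abelian simple groups, these are its quasisimple components. -/
def component (i : ι) : Subgroup G :=
  ⁅(MonoidHom.mulSingle S i).range.comap q, (MonoidHom.mulSingle S i).range.comap q⁆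

variable {q}

lemma map_component (hq : Function.Surjective q) {i : ι} (hS : Group.IsPerfect (S i)) :
    (component q i).map q = (MonoidHom.mulSingle S i).range := by
  rw [component, Subgroup.map_commutator, Subgroup.map_comap_eq_self_of_surjective hq,
    MonoidHom.range_eq_map, ← Subgroup.map_commutator, ← commutator_def, hS.commutator_eq_top]

/-- The preimage of the factor is the component times a central subgroup, and central factors do not
affect commutators. -/
lemma isPerfect_component (hq : Function.Surjective q) (hc : q.ker ≤ Subgroup.center G) {i : ι}
    (hS : Group.IsPerfect (S i)) : Group.IsPerfect (component q i) := by
  rw [Subgroup.isPerfect_iff]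
  have hle : (MonoidHom.mulSingle S i).range.comap q ≤ component q i ⊔ q.ker := by
    rw [← Subgroup.comap_map_eq, map_component hq hS]
  refine le_antisymm (Subgroup.commutator_le_self _) (Subgroup.commutator_le.mpr fun x hx y hy ↦ ?_)
  obtain ⟨a, ha, z, hz, rfl⟩ := Subgroup.mem_sup_of_normal_right.mp (hle hx)
  obtain ⟨b, hb, w, hw, rfl⟩ := Subgroup.mem_sup_of_normal_right.mp (hle hy)
  rw [commutator_mul_mul_of_mem_center a b (hc hz) (hc hw)]
  exact Subgroup.commutator_mem_commutator ha hb

/-- Three subgroups lemma: preimages of distinct factors have commutators in the central kernel. -/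
lemma commutator_component_eq_bot (hc : q.ker ≤ Subgroup.center G) {i j : ι} (hij : i ≠ j) :
    ⁅component q i, (MonoidHom.mulSingle S j).range.comap q⁆ = ⊥ := by
  have key (k l : ι) (hkl : k ≠ l) (K : Subgroup G) :
      ⁅⁅(MonoidHom.mulSingle S k).range.comap q, (MonoidHom.mulSingle S l).range.comap q⁆, K⁆ =
        ⊥ := by
    rw [Subgroup.commutator_eq_bot_iff_le_centralizer]
    refine le_trans ?_ (hc.trans (Subgroup.center_le_centralizer _))
    refine Subgroup.commutator_le.mpr fun x ⟨s, hs⟩ y ⟨t, ht⟩ ↦ ?_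
    rw [MonoidHom.mem_ker, map_commutatorElement, ← hs, ← ht,
      commutatorElement_eq_one_iff_commute]
    exact Pi.mulSingle_commute hkl s t
  exact Subgroup.commutator_commutator_eq_bot_of_rotate (key i j hij _) (key j i hij.symm _)

end

lemma isFiniteQuasisimple_component {G : Type u} {ι : Type*} [Group G] [Finite G] [DecidableEq ι]
    {S : ι → Type u} [∀ i, Group (S i)] {q : G →* ∀ i, S i} (hq : Function.Surjective q)
    (hc : q.ker ≤ Subgroup.center G) {i : ι} (hS : IsNonabelianFiniteSimple (S i)) :
    IsFiniteQuasisimple (component q i) where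
  finite := inferInstance
  perfect := isPerfect_component hq hc hS.isPerfect
  central_extension := by
    have hmap := map_component hq hS.isPerfect
    refine ⟨S i, inferInstance, hS,
      ((Pi.evalMonoidHom S i).comp q).comp (component q i).subtype, fun s ↦ ?_, fun x hx ↦ ?_⟩
    · obtain ⟨x, hx, hxs⟩ : MonoidHom.mulSingle S i s ∈ (component q i).map q := hmap ▸ ⟨s, rfl⟩
      exact ⟨⟨x, hx⟩, by simpa using congrFun hxs i⟩
    · obtain ⟨s, hs⟩ : q x ∈ (MonoidHom.mulSingle S i).range :=
        hmap ▸ Subgroup.mem_map_of_mem q x.2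
      have hx : q x i = 1 := hx
      have hs1 : s = 1 := by simpa [← hs] using hx
      have hxc : (x : G) ∈ Subgroup.center G := hc (by rw [MonoidHom.mem_ker, ← hs, hs1, map_one])
      exact Subgroup.mem_center_iff.mpr fun y ↦ Subtype.ext (Subgroup.mem_center_iff.mp hxc y)

lemma IsFiniteCentralExtensionOfSemisimple.isCentralProduct {G : Type u} [Group G]
    (hG : IsFiniteCentralExtensionOfSemisimple G) :
    IsCentralProductOfQuasisimpleAndAbelian G := by
  classical
  obtain ⟨_, T, _, ⟨ι, _, S, _, hS, ⟨e⟩⟩, p, hp, hpc⟩ := hG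
  let q : G →* ∀ i, S i := e.toMonoidHom.comp p
  have hq : Function.Surjective q := e.surjective.comp hp
  have hc : q.ker ≤ Subgroup.center G := fun x hx ↦ hpc (e.injective (hx.trans (map_one e).symm))
  have hcenter (x : G) (hx : x ∈ q.ker) (y : G) : y * x = x * y :=
    Subgroup.mem_center_iff.mp (hc hx) y
  -- `none` indexes the abelian factor, the kernel.
  refine ⟨Option ι, inferInstance, fun o ↦ o.elim q.ker (component q), ⟨?_, ?_⟩, ?_⟩
  · rintro (_ | i) (_ | j) hij x hx y hy
    · exact (hcenter x hx y).symm
    · exact (hcenter x hx y).symm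
    · exact hcenter y hy x
    · have hij : i ≠ j := fun h ↦ hij (congrArg some h)
      have h := commutator_component_eq_bot (q := q) hc hij
      rw [Subgroup.commutator_eq_bot_iff_le_centralizer] at h
      exact (Subgroup.mem_centralizer_iff.mp (h hx) y (Subgroup.commutator_le_self _ hy)).symm
  · rw [iSup_option]
    change q.ker ⊔ ⨆ i, component q i = ⊤
    rw [sup_comm, ← Subgroup.comap_map_eq, Subgroup.map_iSup]
    refine eq_top_iff.mpr fun g _ ↦ Subgroup.mem_comap.mpr <|
      Subgroup.pi_mem_of_mulSingle_mem _ fun i ↦ Subgroup.mem_iSup_of_mem i ?_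
    rw [map_component hq (hS i).isPerfect]
    exact ⟨q g i, rfl⟩
  · rintro (_ | i)
    · exact .inr ⟨inferInstanceAs (Finite q.ker),
        fun a b ↦ Subtype.ext (hcenter b.1 b.2 a.1)⟩
    · exact .inl (isFiniteQuasisimple_component hq hc (hS i))

end GroupClasses

theorem mainTheorem9 (G : Type*) [Group G] :
    (GroupClasses.SmallestQuasisimpleFormation G ↔
      GroupClasses.IsFiniteCentralExtensionOfSemisimple G) ∧
    (GroupClasses.IsFiniteCentralExtensionOfSemisimple G ↔
      GroupClasses.IsCentralProductOfQuasisimpleAndAbelian G) := by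
  have h₁ : GroupClasses.SmallestQuasisimpleFormation G →
      GroupClasses.IsFiniteCentralExtensionOfSemisimple G := fun h ↦
    h _ GroupClasses.isQuasisimpleFormation_isFiniteCentralExtensionOfSemisimple
  exact ⟨⟨h₁, fun h ↦ h.isCentralProduct.smallestQuasisimpleFormation⟩,
    fun h ↦ h.isCentralProduct, fun h ↦ h₁ h.smallestQuasisimpleFormation⟩
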